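/- Let $P$ be a finite set of points in $\mathbb{R}^2$ and let $\mathcal{R}$ be a finite set of closed axis-parallel rectangles (with non-empty interior) in general position: distinct points of $P$ have distinct $x$-coordinates and distinct $y$-coordinates, the vertical sides of distinct rectangles have distinct $x$-coordinates and their horizontal sides have distinct $y$-coordinates, and no point of $P$ lies on the boundary of a rectangle. Suppose that $\mathcal{R}$ is non-piercing, i.e. there are no $R,R'\in\mathcal{R}$ for which $R\setminus R'$ consists of two connected components. For $q,p\in P$ with $x(q)<x(p)$, the edge $qp$ is drawn as the $L$-shaped curve consisting of the horizontal segment $h(qp)$ from $q$ to the corner $(x(p),y(q))$ and the vertical segment $v(qp)$ from this corner to $p$. Let $R(qp)$ be the axis-parallel rectangle with opposite corners $q$ and $p$. The edge $qp$ is \emph{Delaunay} if the interior of $R(qp)$ contains no point of $P$. It \emph{discretely pierces} a rectangle $R$ if removing the curve from $R$ leaves two connected components, each of which contains a point of $P$. Two edges \emph{cross} if the relative interior of the horizontal segment of one of them meets the relative interior of the vertical segment of the other. An edge is \emph{valid} with respect to a set $E$ of edges if it discretely pierces no rectangle of $\mathcal{R}$ and crosses no edge of $E$. Consider the following algorithm: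 sort $P$ as $p_1,\dots,p_n$ by increasing $x$-coordinate, start with $E=\emptyset$ and, for $i=1,\dots,n$ in this order, add to $E$ all edges $p_jp_i$ with $j<i$ that are Delaunay and valid with respect to the current set $E$. Let $G=(P,E)$ be the resulting graph. Then: 1. $G$ is a support: for every $R\in\mathcal{R}$, the subgraph of $G$ induced by $P\cap R$ is connected (the empty graph counts as connected). 2. Drawing each edge $qp$ of $G$ as the straight-line segment $\overline{qp}$, the diagonal of $R(qp)$, gives a plane embedding of $G$: no point of $P$ lies in the relative interior of an edge, and the relative interiors of distinct edges are disjoint. In particular, $G$ is planar. 3. Every edge of $G$ is Delaunay, and it is valid with respect to the whole final set $E$; that is, no edge discretely pierces a rectangle of $\mathcal{R}$ and no two edges, drawn as $L$-shaped curves, cross. -/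

import Mathlib

/-- The plane `ℝ²`; the first coordinate of a point is its `x`-coordinate, the second one its
`y`-coordinate. -/
abbrev Pt : Type := ℝ × ℝ

/-- A (closed, non-degenerate) axis-parallel rectangle, given by the coordinates of its sides. -/
@[ext]
structure Rect where
  xlo : ℝ
  xhi : ℝ
  ylo : ℝ
  yhi : ℝ
  xlo_lt_xhi : xlo < xhi
  ylo_lt_yhi : ylo < yhi

/-- The set of points of the plane covered by a rectangle. -/
def Rect.region (R : Rect) : Set Pt := Set.Icc R.xlo R.xhi ×ˢ Set.Icc R.ylo R.yhi

/-- `S` consists of exactly two connected components. -/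
def HasTwoComponents (S : Set Pt) : Prop :=
  ∃ a ∈ S, ∃ b ∈ S, connectedComponentIn S a ≠ connectedComponentIn S b ∧
    S = connectedComponentIn S a ∪ connectedComponentIn S b

/-- `S` consists of exactly two connected components, and each of them contains a point of `P`. -/
def HasTwoComponentsMeeting (P : Finset Pt) (S : Set Pt) : Prop :=
  ∃ a ∈ S, ∃ b ∈ S, a ∈ P ∧ b ∈ P ∧ connectedComponentIn S a ≠ connectedComponentIn S b ∧
    S = connectedComponentIn S a ∪ connectedComponentIn S b

/-- `R'` pierces `R`: the difference `R \ R'` consists of two connected components. -/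
def Rect.Pierces (R' R : Rect) : Prop := HasTwoComponents (R.region \ R'.region)

/-- A family of rectangles is non-piercing if no rectangle of it pierces another one. -/
def NonPiercing (𝓡 : Finset Rect) : Prop :=
  ∀ R ∈ 𝓡, ∀ R' ∈ 𝓡, ¬ R'.Pierces R

/-- General position of a set of points and a family of rectangles. -/
structure GeneralPosition (P : Finset Pt) (𝓡 : Finset Rect) : Prop where
  /-- distinct points have distinct `x`-coordinates -/
  points_x : ∀ p ∈ P, ∀ q ∈ P, p.1 = q.1 → p = q
  /-- distinct points have distinct `y`-coordinates -/
  points_y : ∀ p ∈ P, ∀ q ∈ P, p.2 = q.2 → p = q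
  /-- the vertical sides of distinct rectangles have distinct `x`-coordinates -/
  rects_x : ∀ R ∈ 𝓡, ∀ R' ∈ 𝓡, R ≠ R' →
    Disjoint ({R.xlo, R.xhi} : Set ℝ) ({R'.xlo, R'.xhi} : Set ℝ)
  /-- the horizontal sides of distinct rectangles have distinct `y`-coordinates -/
  rects_y : ∀ R ∈ 𝓡, ∀ R' ∈ 𝓡, R ≠ R' →
    Disjoint ({R.ylo, R.yhi} : Set ℝ) ({R'.ylo, R'.yhi} : Set ℝ)
  /-- no point lies on the boundary of a rectangle -/
  not_mem_boundary : ∀ p ∈ P, ∀ R ∈ 𝓡, p ∉ frontier R.region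

/-- An `L`-shaped edge, given by its left end-point and its right end-point. It is drawn as a
horizontal segment starting at the left end-point, followed by a vertical segment ending at the
right end-point (the two shapes are `⌝` and `⌟`). -/
@[ext]
structure LEdge where
  left : Pt
  right : Pt

namespace LEdge

/-- The bend of the `L`-shape. -/
def corner (e : LEdge) : Pt := (e.right.1, e.left.2)

/-- The horizontal segment of the edge. -/
def h (e : LEdge) : Set Pt := segment ℝ e.left e.corner

/-- The vertical segment of the edge. -/
def v (e : LEdge) : Set Pt := segment ℝ e.corner e.right

/-- The `L`-shaped curve. -/
def curve (e : LEdge) : Set Pt := e.h ∪ e.v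

/-- The axis-parallel rectangle with the end-points of the edge as diagonally opposite corners. -/
def box (e : LEdge) : Set Pt :=
  Set.uIcc e.left.1 e.right.1 ×ˢ Set.uIcc e.left.2 e.right.2

/-- A Delaunay edge: the interior of its rectangle contains no point of `P`. -/
def IsDelaunay (P : Finset Pt) (e : LEdge) : Prop := ∀ r ∈ P, r ∉ interior e.box

/-- The edge discretely pierces `R`: removing the `L`-shaped curve from `R` leaves two connected
components, each of which contains a point of `P`. -/
def DiscretelyPierces (P : Finset Pt) (e : LEdge) (R : Rect) : Prop :=
  HasTwoComponentsMeeting P (R.region \ e.curve)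

/-- Two `L`-shaped edges cross: the relative interior of the horizontal segment of one of them
meets the relative interior of the vertical segment of the other one. (Overlaps of two horizontal
or of two vertical segments are not crossings.) -/
def Crosses (e f : LEdge) : Prop :=
  (openSegment ℝ e.left e.corner ∩ openSegment ℝ f.corner f.right).Nonempty ∨
  (openSegment ℝ f.left f.corner ∩ openSegment ℝ e.corner e.right).Nonempty

/-- An edge is valid, relative to the set `E` of existing edges, if it discretely pierces no
rectangle of the family and crosses no existing edge. -/
def IsValid (P : Finset Pt) (𝓡 : Finset Rect) (E : Set LEdge) (e : LEdge) : Prop :=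
  (∀ R ∈ 𝓡, ¬ e.DiscretelyPierces P R) ∧ ∀ f ∈ E, ¬ e.Crosses f

end LEdge

open Classical in
/-- The points of `P` in increasing order of their `x`-coordinates. -/
noncomputable def sweepOrder (P : Finset Pt) : List Pt :=
  P.toList.insertionSort (fun p q => p.1 ≤ q.1)

/-- The set of edges after the first `i` points of the sweep have been processed: processing a
point adds all valid Delaunay edges that join it to a point processed before. -/
noncomputable def sweepEdges (P : Finset Pt) (𝓡 : Finset Rect) : ℕ → Set LEdge
  | 0 => ∅
  | i + 1 => sweepEdges P 𝓡 i ∪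
      {e | ∃ j < i, (sweepOrder P)[j]? = some e.left ∧ (sweepOrder P)[i]? = some e.right ∧
        e.IsDelaunay P ∧ e.IsValid P 𝓡 (sweepEdges P 𝓡 i)}

/-- The edges constructed by the sweep after all points have been processed. -/
noncomputable def sweepOutput (P : Finset Pt) (𝓡 : Finset Rect) : Set LEdge :=
  sweepEdges P 𝓡 P.card

/-- The graph on `P` constructed by the sweep. -/
noncomputable def sweepGraph (P : Finset Pt) (𝓡 : Finset Rect) : SimpleGraph P :=
  SimpleGraph.fromRel fun p q => LEdge.mk p.1 q.1 ∈ sweepOutput P 𝓡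

/-- A graph on the vertex set of a hypergraph is a support if every hyperedge induces a connected
subgraph. (`Preconnected` rather than `Connected`, so that an empty hyperedge is no obstacle.) -/
def IsSupport {V : Type*} (G : SimpleGraph V) (H : Set (Set V)) : Prop :=
  ∀ A ∈ H, (G.induce A).Preconnected

/-- The hyperedges defined by the rectangles: the sets of points of `P` contained in a rectangle. -/
def rectHyperedges (P : Finset Pt) (𝓡 : Finset Rect) : Set (Set P) :=
  {A | ∃ R ∈ 𝓡, A = {p : P | p.1 ∈ R.region}}

/-- Placing the vertices of `G` at the positions `pos` and drawing every edge as the straight-line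
segment between its end-points is a plane embedding: vertices are placed at distinct points, no
vertex lies in the relative interior of an edge, and the relative interiors of distinct edges are
disjoint. -/
structure IsPlaneStraightLineEmbedding {V : Type*} (G : SimpleGraph V) (pos : V → Pt) : Prop where
  injective : Function.Injective pos
  vertex_notMem : ∀ u v w : V, G.Adj u v → pos w ∉ openSegment ℝ (pos u) (pos v)
  disjoint : ∀ u v u' v' : V, G.Adj u v → G.Adj u' v' → s(u, v) ≠ s(u', v') →
    Disjoint (openSegment ℝ (pos u) (pos v)) (openSegment ℝ (pos u') (pos v'))

/-! ### Topological descriptions of piercing -/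

/-! Delaunayness, non-piercing and the absence of crossings mostly come from the tests made by the
sweep; edges added in the same step share their right end-point and cannot cross each other
(`not_crosses_of_mem_sweepOutput`).

Plane drawing: if two diagonals meet with different slopes, the first right end-point and the last
left end-point lie on known sides of the other diagonal. As they avoid its open box, they lie above
or below both of its ends, and this forces the L-shapes to cross (`slope_le_of_not_crosses`). With
equal slopes, a Delaunay edge cannot contain an end-point of the other one, so the edges coincide.

Support: `related_of_mem_window` carries the proof. Among the unrelated pairs in a window choose s,
t horizontally closest. No point of the window's strip lies between them, so st is Delaunay. If it
is not an output edge, something blocked it. A blocking edge f has both ends in the slab between s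
and t, one above and one below the strip, so f discretely pierces O, which is impossible. A blocking
rectangle Q with points below and above st is narrower and taller than O and pierces it. Otherwise Q
lies between s and t vertically and has points on both sides. Any such side point in R is related to
s and to t by induction, with Q in the role of O, so s and t would be related. Hence Q's side points
lie outside R, Q covers the width of R, and Q pierces R. -/

lemma two_components_of_separated {S A B : Set Pt} {f : Pt → ℝ} {c : ℝ} (hf : Continuous f)
    (hS : S = A ∪ B) (hA : IsPreconnected A) (hB : IsPreconnected B)
    (hAc : ∀ z ∈ A, f z < c) (hBc : ∀ z ∈ B, c < f z) {a b : Pt} (ha : a ∈ A) (hb : b ∈ B) :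
    connectedComponentIn S a ≠ connectedComponentIn S b ∧
      S = connectedComponentIn S a ∪ connectedComponentIn S b := by
  have hAS : A ⊆ S := hS ▸ Set.subset_union_left
  have hBS : B ⊆ S := hS ▸ Set.subset_union_right
  have hA' : A ⊆ connectedComponentIn S a := hA.subset_connectedComponentIn ha hAS
  have hB' : B ⊆ connectedComponentIn S b := hB.subset_connectedComponentIn hb hBS
  refine ⟨fun h => ?_, ?_⟩
  · have hb' : b ∈ connectedComponentIn S a := h ▸ hB' hb
    have hsub : connectedComponentIn S a ⊆ {z | f z < c} := by
      refine IsPreconnected.subset_left_of_subset_union (v := {z | c < f z})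
        (isOpen_lt hf continuous_const) (isOpen_lt continuous_const hf) ?_ ?_
        ⟨a, mem_connectedComponentIn (hAS ha), hAc a ha⟩ isPreconnected_connectedComponentIn
      · exact Set.disjoint_left.2 fun z hz hz' => lt_asymm (Set.mem_ofPred.1 hz) hz'
      · intro z hz
        have := connectedComponentIn_subset S a hz
        rw [hS] at this
        exact this.imp (hAc z) (hBc z)
    exact lt_asymm (Set.mem_ofPred.1 (hsub hb')) (hBc b hb)
  · apply Set.Subset.antisymm
    · rw [hS]; rw [hS] at hA' hB'; exact Set.union_subset_union hA' hB'
    · exact Set.union_subset (connectedComponentIn_subset _ _) (connectedComponentIn_subset _ _)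

lemma Rect.pierces_of_vertical {Q O : Rect} (h1 : O.xlo < Q.xlo) (h2 : Q.xhi < O.xhi)
    (h3 : Q.ylo ≤ O.ylo) (h4 : O.yhi ≤ Q.yhi) : Q.Pierces O := by
  have hQ := Q.xlo_lt_xhi
  have hO := O.ylo_lt_yhi
  have hS : O.region \ Q.region = Set.Ico O.xlo Q.xlo ×ˢ Set.Icc O.ylo O.yhi ∪
      Set.Ioc Q.xhi O.xhi ×ˢ Set.Icc O.ylo O.yhi := by
    ext ⟨x, y⟩
    simp only [Rect.region, Set.mem_sdiff, Set.mem_prod, Set.mem_Icc, Set.mem_union, Set.mem_Ico,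
      Set.mem_Ioc]
    constructor
    · rintro ⟨⟨⟨_, _⟩, _, _⟩, hn⟩
      by_cases hx : x < Q.xlo
      · exact Or.inl (by grind)
      · exact Or.inr (by grind)
    · rintro (⟨⟨_, _⟩, _, _⟩ | ⟨⟨_, _⟩, _, _⟩) <;> grind
  have ha : (O.xlo, O.ylo) ∈ Set.Ico O.xlo Q.xlo ×ˢ Set.Icc O.ylo O.yhi :=
    ⟨⟨le_rfl, h1⟩, le_rfl, hO.le⟩
  have hb : (O.xhi, O.ylo) ∈ Set.Ioc Q.xhi O.xhi ×ˢ Set.Icc O.ylo O.yhi :=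
    ⟨⟨h2, le_rfl⟩, le_rfl, hO.le⟩
  exact ⟨_, hS ▸ Or.inl ha, _, hS ▸ Or.inr hb, two_components_of_separated (f := Prod.fst)
    (c := Q.xlo) continuous_fst hS (isPreconnected_Ico.prod isPreconnected_Icc)
    (isPreconnected_Ioc.prod isPreconnected_Icc) (fun z hz => hz.1.2)
    (fun z hz => hQ.trans hz.1.1) ha hb⟩

lemma Rect.pierces_of_horizontal {Q O : Rect} (h1 : O.ylo < Q.ylo) (h2 : Q.yhi < O.yhi)
    (h3 : Q.xlo ≤ O.xlo) (h4 : O.xhi ≤ Q.xhi) : Q.Pierces O := by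
  have hQ := Q.ylo_lt_yhi
  have hO := O.xlo_lt_xhi
  have hS : O.region \ Q.region = Set.Icc O.xlo O.xhi ×ˢ Set.Ico O.ylo Q.ylo ∪
      Set.Icc O.xlo O.xhi ×ˢ Set.Ioc Q.yhi O.yhi := by
    ext ⟨x, y⟩
    simp only [Rect.region, Set.mem_sdiff, Set.mem_prod, Set.mem_Icc, Set.mem_union, Set.mem_Ico,
      Set.mem_Ioc]
    constructor
    · rintro ⟨⟨⟨_, _⟩, _, _⟩, hn⟩
      by_cases hx : y < Q.ylo
      · exact Or.inl (by grind)
      · exact Or.inr (by grind)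
    · rintro (⟨⟨_, _⟩, _, _⟩ | ⟨⟨_, _⟩, _, _⟩) <;> grind
  have ha : (O.xlo, O.ylo) ∈ Set.Icc O.xlo O.xhi ×ˢ Set.Ico O.ylo Q.ylo :=
    ⟨⟨le_rfl, hO.le⟩, le_rfl, h1⟩
  have hb : (O.xlo, O.yhi) ∈ Set.Icc O.xlo O.xhi ×ˢ Set.Ioc Q.yhi O.yhi :=
    ⟨⟨le_rfl, hO.le⟩, h2, le_rfl⟩
  exact ⟨_, hS ▸ Or.inl ha, _, hS ▸ Or.inr hb, two_components_of_separated (f := Prod.snd)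
    (c := Q.ylo) continuous_snd hS (isPreconnected_Icc.prod isPreconnected_Ico)
    (isPreconnected_Icc.prod isPreconnected_Ioc) (fun z hz => hz.2.2)
    (fun z hz => hQ.trans hz.2.1) ha hb⟩

/-! ### Coordinates of edges -/

namespace LEdge

lemma mem_h {e : LEdge} {z : Pt} :
    z ∈ e.h ↔ z.1 ∈ Set.uIcc e.left.1 e.right.1 ∧ z.2 = e.left.2 := by
  obtain ⟨x, y⟩ := z
  have : e.left = (e.left.1, e.left.2) := rfl
  rw [h, corner, this, ← Prod.image_mk_segment_left, segment_eq_uIcc]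
  simp [eq_comm]

lemma mem_v {e : LEdge} {z : Pt} :
    z ∈ e.v ↔ z.1 = e.right.1 ∧ z.2 ∈ Set.uIcc e.left.2 e.right.2 := by
  obtain ⟨x, y⟩ := z
  have : e.right = (e.right.1, e.right.2) := rfl
  rw [v, corner, this, ← Prod.image_mk_segment_right, segment_eq_uIcc]
  simp only [Set.mem_image, Prod.mk.injEq]
  grind

lemma curve_subset_box (e : LEdge) : e.curve ⊆ e.box := by
  rintro z (hz | hz)
  · obtain ⟨h1, h2⟩ := mem_h.1 hz
    exact ⟨h1, h2 ▸ Set.left_mem_uIcc⟩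
  · obtain ⟨h1, h2⟩ := mem_v.1 hz
    exact ⟨h1 ▸ Set.right_mem_uIcc, h2⟩

lemma mem_interior_box {e : LEdge} (he : e.left.1 < e.right.1) {z : Pt} :
    z ∈ interior e.box ↔ (e.left.1 < z.1 ∧ z.1 < e.right.1) ∧
      ((e.left.2 < z.2 ∧ z.2 < e.right.2) ∨ (e.right.2 < z.2 ∧ z.2 < e.left.2)) := by
  rw [box, interior_prod_eq, Set.uIcc_of_le he.le, Set.uIcc, interior_Icc, interior_Icc]
  simp only [Set.mem_prod, Set.mem_Ioo, inf_lt_iff, lt_sup_iff]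
  grind

lemma mem_openSegment_h {e : LEdge} (he : e.left.1 < e.right.1) {z : Pt} :
    z ∈ openSegment ℝ e.left e.corner ↔ (e.left.1 < z.1 ∧ z.1 < e.right.1) ∧ z.2 = e.left.2 := by
  obtain ⟨x, y⟩ := z
  have : e.left = (e.left.1, e.left.2) := rfl
  rw [corner, this, ← Prod.image_mk_openSegment_left, openSegment_eq_Ioo he]
  simp [eq_comm]

lemma mem_openSegment_v {e : LEdge} (he : e.left.2 ≠ e.right.2) {z : Pt} :
    z ∈ openSegment ℝ e.corner e.right ↔ z.1 = e.right.1 ∧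
      ((e.left.2 < z.2 ∧ z.2 < e.right.2) ∨ (e.right.2 < z.2 ∧ z.2 < e.left.2)) := by
  obtain ⟨x, y⟩ := z
  have : e.right = (e.right.1, e.right.2) := rfl
  rw [corner, this, ← Prod.image_mk_openSegment_right, openSegment_eq_Ioo' he]
  simp only [Set.mem_image, Set.mem_Ioo, Prod.mk.injEq, inf_lt_iff, lt_sup_iff]
  grind

lemma crosses_iff {e f : LEdge} (he : e.left.1 < e.right.1) (hf : f.left.1 < f.right.1)
    (he' : e.left.2 ≠ e.right.2) (hf' : f.left.2 ≠ f.right.2) :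
    e.Crosses f ↔
      ((e.left.1 < f.right.1 ∧ f.right.1 < e.right.1) ∧
        ((f.left.2 < e.left.2 ∧ e.left.2 < f.right.2) ∨
          (f.right.2 < e.left.2 ∧ e.left.2 < f.left.2))) ∨
      ((f.left.1 < e.right.1 ∧ e.right.1 < f.right.1) ∧
        ((e.left.2 < f.left.2 ∧ f.left.2 < e.right.2) ∨
          (e.right.2 < f.left.2 ∧ f.left.2 < e.left.2))) := by
  simp only [Crosses, Set.Nonempty, Set.mem_inter_iff, mem_openSegment_h he, mem_openSegment_h hf,
    mem_openSegment_v he', mem_openSegment_v hf']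
  constructor
  · rintro (⟨z, ⟨h1, h2⟩, h3, h4⟩ | ⟨z, ⟨h1, h2⟩, h3, h4⟩)
    · exact Or.inl (by rw [← h2, ← h3]; exact ⟨h1, h4⟩)
    · exact Or.inr (by rw [← h2, ← h3]; exact ⟨h1, h4⟩)
  · rintro (⟨h1, h2⟩ | ⟨h1, h2⟩)
    · exact Or.inl ⟨(f.right.1, e.left.2), ⟨h1, rfl⟩, rfl, h2⟩
    · exact Or.inr ⟨(e.right.1, f.left.2), ⟨h1, rfl⟩, rfl, h2⟩

lemma Crosses.symm {e f : LEdge} (h : e.Crosses f) : f.Crosses e := Or.symm h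

/-- An edge whose vertical segment runs through the whole height of `O`, between two points of `P`
in `O`, discretely pierces `O`. -/
lemma discretelyPierces_of_vertical {P : Finset Pt} {O : Rect} {f : LEdge} {l r : Pt}
    (hl : l ∈ P) (hlO : l ∈ O.region) (hr : r ∈ P) (hrO : r ∈ O.region)
    (hlf : l.1 < f.right.1) (hrf : f.right.1 < r.1)
    (hf : (f.left.2 < O.ylo ∧ O.yhi < f.right.2) ∨ (f.right.2 < O.ylo ∧ O.yhi < f.left.2)) :
    f.DiscretelyPierces P O := by
  have hO := O.ylo_lt_yhi
  obtain ⟨⟨l1, l2⟩, l3⟩ := hlO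
  obtain ⟨⟨r1, r2⟩, r3⟩ := hrO
  have hS : O.region \ f.curve = Set.Ico O.xlo f.right.1 ×ˢ Set.Icc O.ylo O.yhi ∪
      Set.Ioc f.right.1 O.xhi ×ˢ Set.Icc O.ylo O.yhi := by
    ext ⟨x, y⟩
    simp only [Rect.region, curve, Set.mem_sdiff, Set.mem_prod, Set.mem_Icc, Set.mem_union,
      Set.mem_Ico, Set.mem_Ioc, mem_h, mem_v, Set.mem_uIcc]
    constructor
    · rintro ⟨⟨⟨_, _⟩, _, _⟩, hn⟩
      rcases lt_trichotomy x f.right.1 with hx | hx | hx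
      · exact Or.inl (by grind)
      · exact absurd (Or.inr (by grind)) hn
      · exact Or.inr (by grind)
    · rintro (⟨⟨_, _⟩, _, _⟩ | ⟨⟨_, _⟩, _, _⟩) <;> grind
  have ha : l ∈ Set.Ico O.xlo f.right.1 ×ˢ Set.Icc O.ylo O.yhi := ⟨⟨l1, hlf⟩, l3⟩
  have hb : r ∈ Set.Ioc f.right.1 O.xhi ×ˢ Set.Icc O.ylo O.yhi := ⟨⟨hrf, r2⟩, r3⟩
  exact ⟨_, hS ▸ Or.inl ha, _, hS ▸ Or.inr hb, hl, hr, two_components_of_separated (f := Prod.fst)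
    (c := f.right.1) continuous_fst hS (isPreconnected_Ico.prod isPreconnected_Icc)
    (isPreconnected_Ioc.prod isPreconnected_Icc) (fun z hz => hz.1.2) (fun z hz => hz.1.1) ha hb⟩

end LEdge

/-- Removing a box from a rectangle leaves a preconnected set if the box covers neither the width
nor the height of the rectangle. -/
lemma isPreconnected_prod_sdiff_prod {I J K L : Set ℝ} (hI : IsPreconnected I)
    (hJ : IsPreconnected J) (hIK : ¬ I ⊆ K) (hJL : ¬ J ⊆ L) :
    IsPreconnected ((I ×ˢ J) \ (K ×ˢ L)) := by
  obtain ⟨x₀, hx, hxK⟩ := Set.not_subset.1 hIK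
  obtain ⟨y₀, hy, hyL⟩ := Set.not_subset.1 hJL
  refine isPreconnected_of_forall (x₀, y₀) fun z hz => ?_
  obtain ⟨⟨z1, z2⟩, hn⟩ := hz
  -- Through z runs a full horizontal or vertical line of the product that avoids the box; it meets
  -- the full line through `x₀` or `y₀` in the other direction.
  by_cases hzK : z.1 ∈ K
  · have hzL : z.2 ∉ L := fun h => hn ⟨hzK, h⟩
    refine ⟨I ×ˢ {z.2} ∪ {x₀} ×ˢ J, ?_, Or.inr ⟨rfl, hy⟩, Or.inl ⟨z1, rfl⟩,
      IsPreconnected.union (x₀, z.2) ⟨hx, rfl⟩ ⟨rfl, z2⟩ (hI.prod isPreconnected_singleton)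
        (isPreconnected_singleton.prod hJ)⟩
    rintro w (⟨h1, h2⟩ | ⟨h1, h2⟩)
    · rw [Set.mem_singleton_iff] at h2
      exact ⟨⟨h1, h2 ▸ z2⟩, fun h => hzL (h2 ▸ h.2)⟩
    · rw [Set.mem_singleton_iff] at h1
      exact ⟨⟨h1 ▸ hx, h2⟩, fun h => hxK (h1 ▸ h.1)⟩
  · refine ⟨I ×ˢ {y₀} ∪ {z.1} ×ˢ J, ?_, Or.inl ⟨hx, rfl⟩, Or.inr ⟨rfl, z2⟩,
      IsPreconnected.union (z.1, y₀) ⟨z1, rfl⟩ ⟨rfl, hy⟩ (hI.prod isPreconnected_singleton)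
        (isPreconnected_singleton.prod hJ)⟩
    rintro w (⟨h1, h2⟩ | ⟨h1, h2⟩)
    · rw [Set.mem_singleton_iff] at h2
      exact ⟨⟨h1, h2 ▸ hy⟩, fun h => hyL (h2 ▸ h.2)⟩
    · rw [Set.mem_singleton_iff] at h1
      exact ⟨⟨h1 ▸ z1, h2⟩, fun h => hzK (h1 ▸ h.1)⟩

/-- If two points of `Q` outside the box of an edge lie in different components of the complement
of the edge in `Q`, then the box covers the width of `Q` and separates them vertically, or it covers
the height of `Q` and separates them horizontally. -/
lemma box_separates {Q : Rect} {e : LEdge} {a b : Pt} (ha : a ∈ Q.region) (hb : b ∈ Q.region)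
    (hae : a ∉ e.box) (hbe : b ∉ e.box)
    (hab : connectedComponentIn (Q.region \ e.curve) a ≠
      connectedComponentIn (Q.region \ e.curve) b) :
    (Set.Icc Q.xlo Q.xhi ⊆ Set.uIcc e.left.1 e.right.1 ∧
      ∃ c ∈ Set.uIcc e.left.2 e.right.2, (a.2 < c ∧ c < b.2) ∨ (b.2 < c ∧ c < a.2)) ∨
    (Set.Icc Q.ylo Q.yhi ⊆ Set.uIcc e.left.2 e.right.2 ∧
      ∃ c ∈ Set.uIcc e.left.1 e.right.1, (a.1 < c ∧ c < b.1) ∨ (b.1 < c ∧ c < a.1)) := by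
  -- The curve lies in the box, so a preconnected set that avoids the box and contains both points
  -- puts them in one component.
  have key : ∀ T : Set Pt, IsPreconnected T → T ⊆ Q.region \ e.box → a ∈ T → b ∈ T → False := by
    intro T hT hTS haT hbT
    have hsub : T ⊆ Q.region \ e.curve := fun z hz =>
      ⟨(hTS hz).1, fun h => (hTS hz).2 (e.curve_subset_box h)⟩
    exact hab (connectedComponentIn_eq (hT.subset_connectedComponentIn haT hsub hbT))
  by_contra! hcon
  obtain ⟨hV, hH⟩ := hcon
  by_cases hx : Set.Icc Q.xlo Q.xhi ⊆ Set.uIcc e.left.1 e.right.1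
  · have ha2 : a.2 ∉ Set.uIcc e.left.2 e.right.2 := fun h => hae ⟨hx ha.1, h⟩
    have hb2 : b.2 ∉ Set.uIcc e.left.2 e.right.2 := fun h => hbe ⟨hx hb.1, h⟩
    refine key (Set.Icc Q.xlo Q.xhi ×ˢ Set.uIcc a.2 b.2)
      (isPreconnected_Icc.prod isPreconnected_uIcc) ?_ ⟨ha.1, Set.left_mem_uIcc⟩
      ⟨hb.1, Set.right_mem_uIcc⟩
    rintro z ⟨h1, h2⟩
    refine ⟨⟨h1, Set.uIcc_subset_Icc ha.2 hb.2 h2⟩, fun h => ?_⟩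
    have := hV hx z.2 h.2
    have h3 : z.2 ≠ a.2 := fun h' => ha2 (h' ▸ h.2)
    have h4 : z.2 ≠ b.2 := fun h' => hb2 (h' ▸ h.2)
    rw [Set.mem_uIcc] at h2
    grind
  by_cases hy : Set.Icc Q.ylo Q.yhi ⊆ Set.uIcc e.left.2 e.right.2
  · have ha2 : a.1 ∉ Set.uIcc e.left.1 e.right.1 := fun h => hae ⟨h, hy ha.2⟩
    have hb2 : b.1 ∉ Set.uIcc e.left.1 e.right.1 := fun h => hbe ⟨h, hy hb.2⟩
    refine key (Set.uIcc a.1 b.1 ×ˢ Set.Icc Q.ylo Q.yhi)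
      (isPreconnected_uIcc.prod isPreconnected_Icc) ?_ ⟨Set.left_mem_uIcc, ha.2⟩
      ⟨Set.right_mem_uIcc, hb.2⟩
    rintro z ⟨h1, h2⟩
    refine ⟨⟨Set.uIcc_subset_Icc ha.1 hb.1 h1, h2⟩, fun h => ?_⟩
    have := hH hy z.1 h.1
    have h3 : z.1 ≠ a.1 := fun h' => ha2 (h' ▸ h.1)
    have h4 : z.1 ≠ b.1 := fun h' => hb2 (h' ▸ h.1)
    rw [Set.mem_uIcc] at h1
    grind
  exact key _ (isPreconnected_prod_sdiff_prod isPreconnected_Icc isPreconnected_Icc hx hy)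
    subset_rfl ⟨ha, hae⟩ ⟨hb, hbe⟩

/-! ### The sweep -/

lemma length_sweepOrder (P : Finset Pt) : (sweepOrder P).length = P.card := by
  simp [sweepOrder]

lemma mem_sweepOrder {P : Finset Pt} {p : Pt} : p ∈ sweepOrder P ↔ p ∈ P := by
  simp [sweepOrder]

lemma nodup_sweepOrder (P : Finset Pt) : (sweepOrder P).Nodup := by
  classical
  exact (List.perm_insertionSort _ _).nodup_iff.2 P.nodup_toList

lemma pairwise_sweepOrder (P : Finset Pt) : (sweepOrder P).Pairwise (fun p q => p.1 ≤ q.1) := by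
  classical
  have : Std.Total (fun p q : Pt => p.1 ≤ q.1) := ⟨fun p q => le_total _ _⟩
  have : IsTrans Pt (fun p q : Pt => p.1 ≤ q.1) := ⟨fun _ _ _ => le_trans⟩
  exact List.pairwise_insertionSort _ _

section Sweep

variable {P : Finset Pt} {𝓡 : Finset Rect}

lemma mem_of_sweepOrder {i : ℕ} {p : Pt} (h : (sweepOrder P)[i]? = some p) : p ∈ P :=
  mem_sweepOrder.1 (List.mem_of_getElem? h)

lemma sweepOrder_lt (hgp : GeneralPosition P 𝓡) {i j : ℕ} {p q : Pt} (hij : i < j)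
    (hp : (sweepOrder P)[i]? = some p) (hq : (sweepOrder P)[j]? = some q) : p.1 < q.1 := by
  have hpP := mem_of_sweepOrder hp
  have hqP := mem_of_sweepOrder hq
  obtain ⟨hi, rfl⟩ := List.getElem?_eq_some_iff.1 hp
  obtain ⟨hj, rfl⟩ := List.getElem?_eq_some_iff.1 hq
  refine lt_of_le_of_ne (List.pairwise_iff_getElem.1 (pairwise_sweepOrder P) i j hi hj hij) ?_
  intro h
  exact hij.ne ((nodup_sweepOrder P).getElem_inj_iff.1 (hgp.points_x _ hpP _ hqP h))

lemma exists_sweepOrder_eq {p : Pt} (hp : p ∈ P) :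
    ∃ i < P.card, (sweepOrder P)[i]? = some p := by
  obtain ⟨i, hi, h⟩ := List.mem_iff_getElem.1 (mem_sweepOrder.2 hp)
  exact ⟨i, length_sweepOrder P ▸ hi, List.getElem?_eq_some_iff.2 ⟨hi, h⟩⟩

variable (P 𝓡) in
lemma sweepEdges_mono : Monotone (sweepEdges P 𝓡) :=
  monotone_nat_of_le_succ fun _ => Set.subset_union_left

lemma exists_step_of_mem_sweepEdges {k : ℕ} {e : LEdge} (he : e ∈ sweepEdges P 𝓡 k) :
    ∃ i < k, ∃ j < i, (sweepOrder P)[j]? = some e.left ∧ (sweepOrder P)[i]? = some e.right ∧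
      e.IsDelaunay P ∧ e.IsValid P 𝓡 (sweepEdges P 𝓡 i) ∧ e ∈ sweepEdges P 𝓡 (i + 1) := by
  induction k with
  | zero => exact absurd he (Set.notMem_empty e)
  | succ k ih =>
    rcases he with he | he
    · obtain ⟨i, hi, h⟩ := ih he
      exact ⟨i, hi.trans (Nat.lt_succ_self k), h⟩
    · have he' := he
      obtain ⟨j, hj, h1, h2, h3, h4⟩ := he
      exact ⟨k, Nat.lt_succ_self k, j, hj, h1, h2, h3, h4, Or.inr he'⟩

/-- The properties of a single output edge that are used below. -/
structure IsSweepEdge (P : Finset Pt) (𝓡 : Finset Rect) (e : LEdge) : Prop where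
  left_mem : e.left ∈ P
  right_mem : e.right ∈ P
  lt : e.left.1 < e.right.1
  snd_ne : e.left.2 ≠ e.right.2
  delaunay : e.IsDelaunay P
  not_pierces : ∀ R ∈ 𝓡, ¬ e.DiscretelyPierces P R

lemma isSweepEdge_of_mem (hgp : GeneralPosition P 𝓡) {e : LEdge} (he : e ∈ sweepOutput P 𝓡) :
    IsSweepEdge P 𝓡 e := by
  obtain ⟨i, -, j, hj, h1, h2, h3, h4, -⟩ := exists_step_of_mem_sweepEdges he
  have hlt := sweepOrder_lt hgp hj h1 h2
  have hl := mem_of_sweepOrder h1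
  have hr := mem_of_sweepOrder h2
  exact ⟨hl, hr, hlt, fun h => hlt.ne (by rw [hgp.points_y _ hl _ hr h]), h3, h4.1⟩

/-- Of two edges added at different steps, the later one was tested against the earlier one. Edges
added together have their vertical segments on one line, which no relative interior of their
horizontal segments reaches. -/
lemma not_crosses_of_mem_sweepOutput (hgp : GeneralPosition P 𝓡) {e f : LEdge}
    (he : e ∈ sweepOutput P 𝓡) (hf : f ∈ sweepOutput P 𝓡) : ¬ e.Crosses f := by
  have he' := isSweepEdge_of_mem hgp he
  have hf' := isSweepEdge_of_mem hgp hf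
  obtain ⟨i, -, j, hj, h1, h2, h3, h4, h5⟩ := exists_step_of_mem_sweepEdges he
  obtain ⟨i', -, j', hj', h1', h2', h3', h4', h5'⟩ := exists_step_of_mem_sweepEdges hf
  rcases lt_trichotomy i i' with h | rfl | h
  · exact fun hc => h4'.2 e (sweepEdges_mono P 𝓡 h h5) hc.symm
  · have : e.right = f.right := by simpa [h2] using h2'
    rw [LEdge.crosses_iff he'.lt hf'.lt he'.snd_ne hf'.snd_ne, this]
    rintro (⟨h, -⟩ | ⟨h, -⟩) <;> exact lt_irrefl _ h.2
  · exact h4.2 f (sweepEdges_mono P 𝓡 h h5')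

/-- A Delaunay edge is in the output, or it was rejected by the sweep. -/
lemma mem_sweepOutput_or_blocked (hgp : GeneralPosition P 𝓡) {s t : Pt} (hs : s ∈ P) (ht : t ∈ P)
    (hst : s.1 < t.1) (hD : (LEdge.mk s t).IsDelaunay P) :
    LEdge.mk s t ∈ sweepOutput P 𝓡 ∨ (∃ Q ∈ 𝓡, (LEdge.mk s t).DiscretelyPierces P Q) ∨
      ∃ f ∈ sweepOutput P 𝓡, f.right.1 < t.1 ∧ (LEdge.mk s t).Crosses f := by
  obtain ⟨i, hi, hti⟩ := exists_sweepOrder_eq ht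
  obtain ⟨j, -, hsj⟩ := exists_sweepOrder_eq hs
  have hji : j < i := by
    rcases lt_trichotomy j i with h | rfl | h
    · exact h
    · have : s = t := by simpa [hsj] using hti
      exact absurd hst (this ▸ lt_irrefl _)
    · exact absurd (sweepOrder_lt hgp h hti hsj) hst.not_gt
  by_cases hval : (LEdge.mk s t).IsValid P 𝓡 (sweepEdges P 𝓡 i)
  · exact Or.inl (sweepEdges_mono P 𝓡 hi (Or.inr ⟨j, hji, hsj, hti, hD, hval⟩))
  · rw [LEdge.IsValid, not_and_or] at hval
    push Not at hval
    refine Or.inr (hval.imp id ?_)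
    rintro ⟨f, hf, hc⟩
    -- Every edge known before t is processed ends at an earlier point of the sweep.
    refine ⟨f, sweepEdges_mono P 𝓡 hi.le hf, ?_, hc⟩
    obtain ⟨k, hk, -, -, -, h2, -⟩ := exists_step_of_mem_sweepEdges hf
    exact sweepOrder_lt hgp hk h2 hti

end Sweep

/-! ### The straight-line drawing -/

/-- A point above a segment but not inside its bounding box is above both end-points. -/
lemma le_of_above_line {n z₁ z₂ x y c₁ c₂ d₁ d₂ : ℝ} (hc : c₂ = z₂ + n * (c₁ - z₁))
    (hd : d₂ = z₂ + n * (d₁ - z₁)) (hcx : c₁ < x) (hxd : x < d₁) (hy : z₂ + n * (x - z₁) < y)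
    (hn : ¬ ((c₂ < y ∧ y < d₂) ∨ (d₂ < y ∧ y < c₂))) : c₂ ≤ y ∧ d₂ ≤ y := by
  rcases le_total 0 n with h | h
  · have : c₂ ≤ z₂ + n * (x - z₁) := by rw [hc]; nlinarith
    grind
  · have : d₂ ≤ z₂ + n * (x - z₁) := by rw [hd]; nlinarith
    grind

/-- A point below a segment but not inside its bounding box is below both end-points. -/
lemma le_of_below_line {n z₁ z₂ x y c₁ c₂ d₁ d₂ : ℝ} (hc : c₂ = z₂ + n * (c₁ - z₁))
    (hd : d₂ = z₂ + n * (d₁ - z₁)) (hcx : c₁ < x) (hxd : x < d₁) (hy : y < z₂ + n * (x - z₁))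
    (hn : ¬ ((c₂ < y ∧ y < d₂) ∨ (d₂ < y ∧ y < c₂))) : y ≤ c₂ ∧ y ≤ d₂ := by
  -- Reflection in the x-axis reduces this to the previous case.
  have := @le_of_above_line (-n) z₁ (-z₂) x (-y) c₁ (-c₂) d₁ (-d₂) (by rw [hc]; ring)
    (by rw [hd]; ring) hcx hxd (by linarith) (by grind)
  exact ⟨by linarith [this.1], by linarith [this.2]⟩

lemma exists_slope_of_mem_openSegment {a b z : Pt} (hab : a.1 < b.1)
    (hz : z ∈ openSegment ℝ a b) : (a.1 < z.1 ∧ z.1 < b.1) ∧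
      ∃ m : ℝ, a.2 = z.2 + m * (a.1 - z.1) ∧ b.2 = z.2 + m * (b.1 - z.1) := by
  obtain ⟨u, v, hu, hv, huv, rfl⟩ := hz
  obtain rfl : u = 1 - v := by linarith
  have hne : b.1 - a.1 ≠ 0 := by linarith
  simp only [Prod.fst_add, Prod.smul_fst, smul_eq_mul, Prod.snd_add, Prod.smul_snd]
  refine ⟨⟨by nlinarith, by nlinarith⟩, (b.2 - a.2) / (b.1 - a.1), ?_, ?_⟩ <;> field_simp <;> ring

lemma mem_interior_box_of_mem_openSegment {e : LEdge} (he : e.left.1 < e.right.1)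
    (he' : e.left.2 ≠ e.right.2) {z : Pt} (hz : z ∈ openSegment ℝ e.left e.right) :
    z ∈ interior e.box := by
  rw [LEdge.mem_interior_box he]
  obtain ⟨u, v, hu, hv, huv, rfl⟩ := hz
  obtain rfl : u = 1 - v := by linarith
  simp only [Prod.fst_add, Prod.smul_fst, smul_eq_mul, Prod.snd_add, Prod.smul_snd]
  refine ⟨⟨by nlinarith, by nlinarith⟩, ?_⟩
  rcases lt_or_gt_of_ne he' with h | h
  · exact Or.inl ⟨by nlinarith, by nlinarith⟩
  · exact Or.inr ⟨by nlinarith, by nlinarith⟩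

section Drawing

variable {P : Finset Pt} {𝓡 : Finset Rect}

/-- If the first edge were steeper, it would be above the second to the right of z and below it to
the left; the empty boxes then turn this local order into a crossing of the L-shapes. -/
lemma slope_le_of_not_crosses (hgp : GeneralPosition P 𝓡) {e f : LEdge} (he : IsSweepEdge P 𝓡 e)
    (hf : IsSweepEdge P 𝓡 f) (hc : ¬ e.Crosses f) {z : Pt} {m n : ℝ}
    (he1 : e.left.1 < z.1) (he2 : z.1 < e.right.1) (hf1 : f.left.1 < z.1) (hf2 : z.1 < f.right.1)
    (ha : e.left.2 = z.2 + m * (e.left.1 - z.1)) (hb : e.right.2 = z.2 + m * (e.right.1 - z.1))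
    (hc' : f.left.2 = z.2 + n * (f.left.1 - z.1)) (hd : f.right.2 = z.2 + n * (f.right.1 - z.1)) :
    m ≤ n := by
  by_contra! hmn
  rw [LEdge.crosses_iff he.lt hf.lt he.snd_ne hf.snd_ne] at hc
  have hDe : ∀ r ∈ P, _ := fun r hr h => he.delaunay r hr ((LEdge.mem_interior_box he.lt).2 h)
  have hDf : ∀ r ∈ P, _ := fun r hr h => hf.delaunay r hr ((LEdge.mem_interior_box hf.lt).2 h)
  have hal := he.left_mem
  have har := he.right_mem
  have hfl := hf.left_mem
  have hfr := hf.right_mem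
  -- The right end-point that comes first lies within the horizontal range of the other edge, on a
  -- side given by the slopes, and outside its open box. A common right end-point would make the
  -- slopes equal.
  have hright : (f.left.1 < e.right.1 ∧ e.right.1 < f.right.1 ∧ f.left.2 ≤ e.right.2 ∧
      f.right.2 ≤ e.right.2) ∨ (e.left.1 < f.right.1 ∧ f.right.1 < e.right.1 ∧
      f.right.2 ≤ e.left.2 ∧ f.right.2 ≤ e.right.2) := by
    rcases lt_trichotomy e.right.1 f.right.1 with h | h | h
    · exact Or.inl ⟨by linarith, h, le_of_above_line hc' hd (by linarith) h
        (by rw [hb]; nlinarith) fun h' => hDf _ har ⟨⟨by linarith, h⟩, h'⟩⟩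
    · have := hgp.points_x _ har _ hfr h
      rw [← this, hb] at hd
      nlinarith
    · exact Or.inr ⟨by linarith, h, le_of_below_line ha hb (by linarith) h
        (by rw [hd]; nlinarith) fun h' => hDe _ hfr ⟨⟨by linarith, h⟩, h'⟩⟩
  have hleft : (f.left.1 < e.left.1 ∧ e.left.1 < f.right.1 ∧ e.left.2 ≤ f.left.2 ∧
      e.left.2 ≤ f.right.2) ∨ (e.left.1 < f.left.1 ∧ f.left.1 < e.right.1 ∧
      e.left.2 ≤ f.left.2 ∧ e.right.2 ≤ f.left.2) := by
    rcases lt_trichotomy e.left.1 f.left.1 with h | h | h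
    · exact Or.inr ⟨h, by linarith, le_of_above_line ha hb h (by linarith)
        (by rw [hc']; nlinarith) fun h' => hDe _ hfl ⟨⟨h, by linarith⟩, h'⟩⟩
    · have := hgp.points_x _ hal _ hfl h
      rw [← this, ha] at hc'
      nlinarith
    · exact Or.inl ⟨h, by linarith, le_of_below_line hc' hd h (by linarith)
        (by rw [ha]; nlinarith) fun h' => hDf _ hal ⟨⟨h, by linarith⟩, h'⟩⟩
  have hne : ∀ p ∈ P, ∀ q ∈ P, p.1 < q.1 → p.2 ≠ q.2 := fun p hp q hq h h' =>
    h.ne (by rw [hgp.points_y p hp q hq h'])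
  -- If both extreme ends belong to the same edge, the L-shapes cross; the mixed cases force two
  -- distinct points to equal height.
  rcases hright with ⟨r1, r2, r3, r4⟩ | ⟨r1, r2, r3, r4⟩ <;>
    rcases hleft with ⟨l1, l2, l3, l4⟩ | ⟨l1, l2, l3, l4⟩
  · have h1 := hne _ hfl _ hal l1
    have h2 := hne _ hfl _ har r1
    exact hc (Or.inr ⟨⟨r1, r2⟩, Or.inl ⟨lt_of_le_of_ne l3 h1.symm, lt_of_le_of_ne r3 h2⟩⟩)
  · exact hne _ hfl _ har r1 (le_antisymm r3 l4)
  · exact hne _ hal _ hfr r1 (le_antisymm l4 r3)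
  · have h1 := hne _ hal _ hfl l1
    have h2 := hne _ hal _ hfr r1
    exact hc (Or.inl ⟨⟨r1, r2⟩, Or.inr ⟨lt_of_le_of_ne r3 h2.symm, lt_of_le_of_ne l3 h1⟩⟩)

/-- Comparing slopes both ways makes the edges collinear with nonzero slope. An end-point of one
strictly inside the other would then lie in that edge's open box, so their ends agree. -/
lemma eq_of_mem_openSegment (hgp : GeneralPosition P 𝓡) {e f : LEdge} (he : IsSweepEdge P 𝓡 e)
    (hf : IsSweepEdge P 𝓡 f) (hc : ¬ e.Crosses f) {z : Pt}
    (hze : z ∈ openSegment ℝ e.left e.right) (hzf : z ∈ openSegment ℝ f.left f.right) :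
    e = f := by
  obtain ⟨⟨e1, e2⟩, m, ha, hb⟩ := exists_slope_of_mem_openSegment he.lt hze
  obtain ⟨⟨f1, f2⟩, n, hc', hd⟩ := exists_slope_of_mem_openSegment hf.lt hzf
  obtain rfl : m = n := le_antisymm
    (slope_le_of_not_crosses hgp he hf hc e1 e2 f1 f2 ha hb hc' hd)
    (slope_le_of_not_crosses hgp hf he (fun h => hc h.symm) f1 f2 e1 e2 hc' hd ha hb)
  have hm : m ≠ 0 := by
    rintro rfl
    exact he.snd_ne (by rw [ha, hb]; ring)
  have key : ∀ g : LEdge, IsSweepEdge P 𝓡 g → g.left.2 = z.2 + m * (g.left.1 - z.1) →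
      g.right.2 = z.2 + m * (g.right.1 - z.1) → ∀ p ∈ P, p.2 = z.2 + m * (p.1 - z.1) →
      ¬ (g.left.1 < p.1 ∧ p.1 < g.right.1) := by
    rintro g hg hl hr p hp hpz ⟨h1, h2⟩
    refine hg.delaunay p hp ((LEdge.mem_interior_box hg.lt).2 ⟨⟨h1, h2⟩, ?_⟩)
    rcases lt_or_gt_of_ne hm with h | h
    · exact Or.inr ⟨by nlinarith, by nlinarith⟩
    · exact Or.inl ⟨by nlinarith, by nlinarith⟩
  have k1 := key e he ha hb _ hf.left_mem hc'
  have k2 := key e he ha hb _ hf.right_mem hd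
  have k3 := key f hf hc' hd _ he.left_mem ha
  have k4 := key f hf hc' hd _ he.right_mem hb
  refine LEdge.ext (hgp.points_x _ he.left_mem _ hf.left_mem ?_)
    (hgp.points_x _ he.right_mem _ hf.right_mem ?_)
  · by_contra h
    rcases lt_or_gt_of_ne h with h | h
    · exact k1 ⟨h, by linarith⟩
    · exact k3 ⟨h, by linarith⟩
  · by_contra h
    rcases lt_or_gt_of_ne h with h | h
    · exact k4 ⟨by linarith, h⟩
    · exact k2 ⟨by linarith, h⟩

lemma exists_edge_of_adj {u v : P} (h : (sweepGraph P 𝓡).Adj u v) :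
    ∃ e ∈ sweepOutput P 𝓡, (e.left = u ∧ e.right = v) ∨ (e.left = v ∧ e.right = u) := by
  rcases ((SimpleGraph.fromRel_adj _ _ _).1 h).2 with h | h
  · exact ⟨_, h, Or.inl ⟨rfl, rfl⟩⟩
  · exact ⟨_, h, Or.inr ⟨rfl, rfl⟩⟩

lemma isPlaneStraightLineEmbedding_sweepGraph (hgp : GeneralPosition P 𝓡) :
    IsPlaneStraightLineEmbedding (sweepGraph P 𝓡) (fun p : P => (p : Pt)) := by
  have hseg : ∀ {u v : P} {e : LEdge},
      (e.left = u ∧ e.right = v) ∨ (e.left = v ∧ e.right = u) →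
      openSegment ℝ (u : Pt) v = openSegment ℝ e.left e.right := by
    rintro u v e (⟨h1, h2⟩ | ⟨h1, h2⟩)
    · rw [h1, h2]
    · rw [h1, h2, openSegment_symm]
  refine ⟨Subtype.val_injective, ?_, ?_⟩
  · intro u v w h hw
    obtain ⟨e, he, huv⟩ := exists_edge_of_adj h
    have he' := isSweepEdge_of_mem hgp he
    simp only [hseg huv] at hw
    exact he'.delaunay w w.2 (mem_interior_box_of_mem_openSegment he'.lt he'.snd_ne hw)
  · intro u v u' v' h h' hne
    obtain ⟨e, he, huv⟩ := exists_edge_of_adj h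
    obtain ⟨f, hf, huv'⟩ := exists_edge_of_adj h'
    simp only [hseg huv, hseg huv']
    refine Set.disjoint_left.2 fun z hz hz' => hne ?_
    have := eq_of_mem_openSegment hgp (isSweepEdge_of_mem hgp he) (isSweepEdge_of_mem hgp hf)
      (not_crosses_of_mem_sweepOutput hgp he hf) hz hz'
    subst this
    rw [Sym2.eq_iff]
    simp only [Subtype.ext_iff]
    rcases huv with ⟨h1, h2⟩ | ⟨h1, h2⟩ <;> rcases huv' with ⟨h3, h4⟩ | ⟨h3, h4⟩ <;>
      simp_all

end Drawing

/-! ### The support property -/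

section Support

variable {P : Finset Pt} {𝓡 : Finset Rect}

lemma GeneralPosition.strict (hgp : GeneralPosition P 𝓡) {p : Pt} (hp : p ∈ P) {R : Rect}
    (hR : R ∈ 𝓡) (h : p ∈ R.region) :
    (R.xlo < p.1 ∧ p.1 < R.xhi) ∧ (R.ylo < p.2 ∧ p.2 < R.yhi) := by
  have hc : IsClosed R.region := isClosed_Icc.prod isClosed_Icc
  have hi : p ∈ interior R.region := by
    by_contra h'
    exact hgp.not_mem_boundary p hp R hR (hc.frontier_eq ▸ ⟨h, h'⟩)
  rw [Rect.region, interior_prod_eq, interior_Icc, interior_Icc] at hi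
  exact hi

/-- A rectangle that is discretely pierced by a Delaunay edge lies between its end-points
horizontally and has points below and above the edge, or it lies between them vertically and has
points to the left and to the right. -/
lemma LEdge.DiscretelyPierces.cases (hgp : GeneralPosition P 𝓡) {s t : Pt} (hs : s ∈ P)
    (ht : t ∈ P) (hst : s.1 < t.1) (hD : (LEdge.mk s t).IsDelaunay P) {Q : Rect} (hQ : Q ∈ 𝓡)
    (h : (LEdge.mk s t).DiscretelyPierces P Q) :
    ((s.1 ≤ Q.xlo ∧ Q.xhi ≤ t.1) ∧ ∃ d ∈ P, ∃ u ∈ P, d ∈ Q.region ∧ u ∈ Q.region ∧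
      (d.2 < s.2 ∧ d.2 < t.2) ∧ (s.2 < u.2 ∧ t.2 < u.2)) ∨
    (((s.2 < Q.ylo ∧ Q.yhi < t.2) ∨ (t.2 < Q.ylo ∧ Q.yhi < s.2)) ∧
      ∃ l ∈ P, ∃ r ∈ P, l ∈ Q.region ∧ r ∈ Q.region ∧ l.1 < s.1 ∧ t.1 < r.1) := by
  obtain ⟨a, ha, b, hb, haP, hbP, hab, -⟩ := h
  -- By general position the boundary of the box contains no point of P except s and t, which lie on
  -- the curve.
  have hbox : ∀ p ∈ P, p ∉ (LEdge.mk s t).curve → p ∉ (LEdge.mk s t).box := by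
    intro p hp hpc hpb
    have hps : p ≠ s := by
      rintro rfl
      exact hpc (Or.inl (LEdge.mem_h.2 ⟨Set.left_mem_uIcc, rfl⟩))
    have hpt : p ≠ t := by
      rintro rfl
      exact hpc (Or.inr (LEdge.mem_v.2 ⟨rfl, Set.right_mem_uIcc⟩))
    refine hD p hp ((LEdge.mem_interior_box hst).2 ?_)
    obtain ⟨h1, h2⟩ := hpb
    have e1 := mt (hgp.points_x p hp s hs) hps
    have e2 := mt (hgp.points_x p hp t ht) hpt
    have e3 := mt (hgp.points_y p hp s hs) hps
    have e4 := mt (hgp.points_y p hp t ht) hpt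
    rw [Set.mem_uIcc] at h1 h2
    grind
  have hae := hbox a haP ha.2
  have hbe := hbox b hbP hb.2
  have haQ := ha.1
  have hbQ := hb.1
  rcases box_separates ha.1 hb.1 hae hbe hab with ⟨hx, c, hc, hcab⟩ | ⟨hy, c, hc, hcab⟩
  · left
    have ha2 : a.2 ∉ Set.uIcc s.2 t.2 := fun h => hae ⟨hx haQ.1, h⟩
    have hb2 : b.2 ∉ Set.uIcc s.2 t.2 := fun h => hbe ⟨hx hbQ.1, h⟩
    have h1 := hx (Set.left_mem_Icc.2 Q.xlo_lt_xhi.le)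
    have h2 := hx (Set.right_mem_Icc.2 Q.xlo_lt_xhi.le)
    simp only [Set.uIcc_of_le hst.le] at h1 h2
    refine ⟨⟨h1.1, h2.2⟩, ?_⟩
    simp only [Set.mem_uIcc] at ha2 hb2 hc
    rcases hcab with h | h
    · exact ⟨a, haP, b, hbP, haQ, hbQ, by grind, by grind⟩
    · exact ⟨b, hbP, a, haP, hbQ, haQ, by grind, by grind⟩
  · right
    have ha2 : a.1 ∉ Set.uIcc s.1 t.1 := fun h => hae ⟨h, hy haQ.2⟩
    have hb2 : b.1 ∉ Set.uIcc s.1 t.1 := fun h => hbe ⟨h, hy hbQ.2⟩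
    simp only [Set.uIcc_of_le hst.le, Set.mem_Icc] at ha2 hb2 hc
    have hlr : ∃ l ∈ P, ∃ r ∈ P, l ∈ Q.region ∧ r ∈ Q.region ∧ l.1 < s.1 ∧ t.1 < r.1 := by
      rcases hcab with h | h
      · exact ⟨a, haP, b, hbP, haQ, hbQ, by grind, by grind⟩
      · exact ⟨b, hbP, a, haP, hbQ, haQ, by grind, by grind⟩
    refine ⟨?_, hlr⟩
    obtain ⟨l, -, r, -, hl, hr, hls, htr⟩ := hlr
    have hQy := Q.ylo_lt_yhi
    -- This makes the vertical inequalities strict: s and t lie within the width of Q, so on a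
    -- horizontal side of Q they would be boundary points.
    have hout : ∀ p ∈ P, s.1 ≤ p.1 → p.1 ≤ t.1 → p.2 ≠ Q.ylo ∧ p.2 ≠ Q.yhi := by
      intro p hp h1 h2
      have hpx : p.1 ∈ Set.Icc Q.xlo Q.xhi :=
        ⟨hl.1.1.trans (by linarith), le_trans (by linarith) hr.1.2⟩
      constructor <;> intro h
      · exact (hgp.strict hp hQ ⟨hpx, h.ge, h.trans_le hQy.le⟩).2.1.ne' h
      · exact (hgp.strict hp hQ ⟨hpx, hQy.le.trans h.ge, h.le⟩).2.2.ne h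
    have h1 := hy (Set.left_mem_Icc.2 hQy.le)
    have h2 := hy (Set.right_mem_Icc.2 hQy.le)
    have o1 := hout s hs le_rfl hst.le
    have o2 := hout t ht hst.le le_rfl
    simp only [Set.mem_uIcc] at h1 h2
    grind

/-- The main induction. The window `[x₁, x₂] × [y₁, y₂]` spans the height of a rectangle `O` of the
family that has points on both sides of the window. If all points in the window belong to `R`, then
any two of them are related by every equivalence relation that relates the end-points of the
output edges inside `R`. -/
lemma related_of_mem_window (hgp : GeneralPosition P 𝓡) (hnp : NonPiercing 𝓡) {R : Rect}
    (hR : R ∈ 𝓡) {C : Pt → Pt → Prop} (hrefl : ∀ p ∈ P, p ∈ R.region → C p p)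
    (hsymm : ∀ p q, C p q → C q p) (htrans : ∀ p q r, C p q → C q r → C p r)
    (hC : ∀ e ∈ sweepOutput P 𝓡, e.left ∈ R.region → e.right ∈ R.region → C e.left e.right)
    (n : ℕ) : ∀ (O : Rect) (l r : Pt) (x₁ x₂ y₁ y₂ : ℝ),
      (P.filter fun z => y₁ ≤ z.2 ∧ z.2 ≤ y₂).card < n →
      O ∈ 𝓡 → l ∈ P → l ∈ O.region → r ∈ P → r ∈ O.region → l.1 ≤ x₁ → x₂ ≤ r.1 →
      y₁ ≤ O.ylo → O.yhi ≤ y₂ →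
      (∀ z ∈ P, (x₁ ≤ z.1 ∧ z.1 ≤ x₂) → (y₁ ≤ z.2 ∧ z.2 ≤ y₂) → z ∈ R.region) →
      ∀ s ∈ P, ∀ t ∈ P, (x₁ ≤ s.1 ∧ s.1 ≤ x₂) → (y₁ ≤ s.2 ∧ s.2 ≤ y₂) →
        (x₁ ≤ t.1 ∧ t.1 ≤ x₂) → (y₁ ≤ t.2 ∧ t.2 ≤ y₂) → C s t := by
  -- The count is over the whole horizontal strip, since the windows used recursively may extend
  -- horizontally beyond the present one.
  induction n with
  | zero => intro _ _ _ _ _ _ _ h; exact absurd h (Nat.not_lt_zero _)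
  | succ n ih =>
  intro O l r x₁ x₂ y₁ y₂ hcard hO hl hlO hr hrO hlx hrx hy1 hy2 hW
  by_contra! hbad
  -- a pair of unrelated points of minimal horizontal distance
  obtain ⟨s, hs, t, ht, hsx, hsy, htx, hty, hnC, hst, hmin⟩ : ∃ s ∈ P, ∃ t ∈ P,
      (x₁ ≤ s.1 ∧ s.1 ≤ x₂) ∧ (y₁ ≤ s.2 ∧ s.2 ≤ y₂) ∧ (x₁ ≤ t.1 ∧ t.1 ≤ x₂) ∧
      (y₁ ≤ t.2 ∧ t.2 ≤ y₂) ∧ ¬ C s t ∧ s.1 < t.1 ∧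
      ∀ z ∈ P, (s.1 < z.1 ∧ z.1 < t.1) → ¬ (y₁ ≤ z.2 ∧ z.2 ≤ y₂) := by
    classical
    let B := (P ×ˢ P).filter fun p => ((x₁ ≤ p.1.1 ∧ p.1.1 ≤ x₂) ∧ (y₁ ≤ p.1.2 ∧ p.1.2 ≤ y₂) ∧
      (x₁ ≤ p.2.1 ∧ p.2.1 ≤ x₂) ∧ (y₁ ≤ p.2.2 ∧ p.2.2 ≤ y₂)) ∧ ¬ C p.1 p.2 ∧ p.1.1 < p.2.1
    have hmem : ∀ {a b : Pt}, a ∈ P → b ∈ P → (x₁ ≤ a.1 ∧ a.1 ≤ x₂) → (y₁ ≤ a.2 ∧ a.2 ≤ y₂) →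
        (x₁ ≤ b.1 ∧ b.1 ≤ x₂) → (y₁ ≤ b.2 ∧ b.2 ≤ y₂) → ¬ C a b → a.1 < b.1 → (a, b) ∈ B :=
      fun ha hb h1 h2 h3 h4 h5 h6 => Finset.mem_filter.2
        ⟨Finset.mk_mem_product ha hb, ⟨h1, h2, h3, h4⟩, h5, h6⟩
    have hB : B.Nonempty := by
      obtain ⟨s, hs, t, ht, h1, h2, h3, h4, h5⟩ := hbad
      rcases lt_trichotomy s.1 t.1 with h | h | h
      · exact ⟨_, hmem hs ht h1 h2 h3 h4 h5 h⟩
      · have := hgp.points_x s hs t ht h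
        subst this
        exact absurd (hrefl s hs (hW s hs h1 h2)) h5
      · exact ⟨_, hmem ht hs h3 h4 h1 h2 (fun h' => h5 (hsymm _ _ h')) h⟩
    obtain ⟨⟨s, t⟩, hstB, hmin⟩ := B.exists_min_image (fun p => p.2.1 - p.1.1) hB
    obtain ⟨h0, ⟨h1, h2, h3, h4⟩, h5, h6⟩ := Finset.mem_filter.1 hstB
    obtain ⟨hs, ht⟩ := Finset.mem_product.1 h0
    refine ⟨s, hs, t, ht, h1, h2, h3, h4, h5, h6, fun z hz hzx hzy => ?_⟩
    dsimp only at *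
    have hzx' : x₁ ≤ z.1 ∧ z.1 ≤ x₂ := ⟨by linarith, by linarith⟩
    -- By transitivity z is unrelated to s or to t, which gives a closer pair.
    by_cases hsz : C s z
    · have := hmin _ (hmem hz ht hzx' hzy h3 h4 (fun h => h5 (htrans _ _ _ hsz h)) hzx.2)
      dsimp only at this
      linarith
    · have := hmin _ (hmem hs hz h1 h2 hzx' hzy hsz hzx.1)
      dsimp only at this
      linarith
  have hsR := hW s hs hsx hsy
  have htR := hW t ht htx hty
  have hsO := hgp.strict hl hO hlO
  have hrO' := hgp.strict hr hO hrO
  have hD : (LEdge.mk s t).IsDelaunay P := by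
    intro z hz hzi
    obtain ⟨h1, h2⟩ := (LEdge.mem_interior_box (e := ⟨s, t⟩) hst).1 hzi
    dsimp only at h1 h2
    exact hmin z hz h1 (by rcases h2 with h2 | h2 <;> constructor <;> linarith)
  rcases mem_sweepOutput_or_blocked hgp hs ht hst hD with h | ⟨Q, hQ, hpQ⟩ | ⟨f, hf, hft, hcr⟩
  · exact hnC (hC _ h hsR htR)
  · rcases hpQ.cases hgp hs ht hst hD hQ with
      ⟨⟨hQ1, hQ2⟩, d, hd, u, hu, hdQ, huQ, hdst, hust⟩ | ⟨hQy, a, ha, b, hb, haQ, hbQ, has, htb⟩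
    -- Both d and u lie in the empty slab, hence below and above the strip; so Q covers the height
    -- of O strictly between l and r.
    · have hd' := hgp.strict hd hQ hdQ
      have hu' := hgp.strict hu hQ huQ
      have md := hmin d hd ⟨by linarith, by linarith⟩
      have mu := hmin u hu ⟨by linarith, by linarith⟩
      exact hnp O hO Q hQ (Rect.pierces_of_vertical (by linarith) (by linarith) (by grind)
        (by grind))
    · have hsR' := hgp.strict hs hR hsR
      have htR' := hgp.strict ht hR htR
      have haQ' := hgp.strict ha hQ haQ
      have hbQ' := hgp.strict hb hQ hbQ
      -- the windows between `Q` and an end-point of the edge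
      have step : ∀ p, (p = s ∨ p = t) → ∀ z ∈ P, z ∈ Q.region → z ∈ R.region →
          (z.1 < s.1 ∨ t.1 < z.1) → C p z := by
        intro p hp z hz hzQ hzR hzst
        have hpP : p ∈ P := by rcases hp with rfl | rfl <;> assumption
        have hzQ' := hgp.strict hz hQ hzQ
        have hzR' := hgp.strict hz hR hzR
        -- A smaller strip that misses a point q of the old one has fewer points.
        have hcard' : ∀ v₁ v₂ q, q ∈ P → y₁ ≤ v₁ → v₂ ≤ y₂ → y₁ ≤ q.2 → q.2 ≤ y₂ →
            (q.2 < v₁ ∨ v₂ < q.2) → (P.filter fun z => v₁ ≤ z.2 ∧ z.2 ≤ v₂).card < n := by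
          intro v₁ v₂ q hq h1 h2 h3 h4 h5
          refine lt_of_lt_of_le (Finset.card_lt_card ?_) (Nat.lt_succ_iff.1 hcard)
          refine (Finset.ssubset_iff_of_subset ?_).2 ⟨q, ?_, ?_⟩
          · intro w hw
            obtain ⟨hw, h6, h7⟩ := Finset.mem_filter.1 hw
            exact Finset.mem_filter.2 ⟨hw, by linarith, by linarith⟩
          · exact Finset.mem_filter.2 ⟨hq, h3, h4⟩
          · intro hq'
            obtain ⟨-, h6, h7⟩ := Finset.mem_filter.1 hq'
            rcases h5 with h5 | h5 <;> linarith
        -- Here q is the other end-point of the edge, on the opposite side of Q from p.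
        have hpb : (p.2 < Q.ylo ∧ y₁ ≤ p.2 ∧ ∃ q ∈ P, Q.yhi < q.2 ∧ q.2 ≤ y₂ ∧ q.2 < R.yhi) ∨
            (Q.yhi < p.2 ∧ p.2 ≤ y₂ ∧ ∃ q ∈ P, q.2 < Q.ylo ∧ y₁ ≤ q.2 ∧ R.ylo < q.2) := by
          rcases hp with rfl | rfl
          · rcases hQy with h | h
            · exact Or.inl ⟨h.1, hsy.1, t, ht, h.2, hty.2, htR'.2.2⟩
            · exact Or.inr ⟨h.2, hsy.2, t, ht, h.1, hty.1, htR'.2.1⟩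
          · rcases hQy with h | h
            · exact Or.inr ⟨h.2, hty.2, s, hs, h.1, hsy.1, hsR'.2.1⟩
            · exact Or.inl ⟨h.1, hty.1, s, hs, h.2, hsy.2, hsR'.2.2⟩
        have hpst : (s.1 ≤ p.1 ∧ p.1 ≤ t.1) ∧ (R.ylo < p.2 ∧ p.2 < R.yhi) := by
          rcases hp with rfl | rfl
          · exact ⟨⟨le_rfl, hst.le⟩, hsR'.2⟩
          · exact ⟨⟨hst.le, le_rfl⟩, htR'.2⟩
        -- The new strip runs from p to the far side of Q. It drops q, and it stays within the
        -- height of R because p and q both lie in R.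
        obtain ⟨v₁, v₂, hv, hv1, hv2, hpv, hvR⟩ : ∃ v₁ v₂ : ℝ,
            (P.filter fun z => v₁ ≤ z.2 ∧ z.2 ≤ v₂).card < n ∧ v₁ ≤ Q.ylo ∧ Q.yhi ≤ v₂ ∧
            (v₁ ≤ p.2 ∧ p.2 ≤ v₂) ∧ (R.ylo ≤ v₁ ∧ v₂ ≤ R.yhi) := by
          have hQyy := Q.ylo_lt_yhi
          rcases hpb with ⟨h1, h2, q, hq, h3, h4, h5⟩ | ⟨h1, h2, q, hq, h3, h4, h5⟩
          · exact ⟨p.2, Q.yhi, hcard' _ _ q hq h2 (by linarith) (by linarith) h4 (Or.inr h3),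
              h1.le, le_rfl, ⟨le_rfl, by linarith⟩, hpst.2.1.le, by linarith⟩
          · exact ⟨Q.ylo, p.2, hcard' _ _ q hq (by linarith) h2 h4 (by linarith) (Or.inl h3),
              le_rfl, h1.le, ⟨by linarith, le_rfl⟩, by linarith, hpst.2.2.le⟩
        have hzv : v₁ ≤ z.2 ∧ z.2 ≤ v₂ := ⟨by linarith, by linarith⟩
        have hsx' := hsR'.1
        have htx' := htR'.1
        -- The new window lies between z and p, both in R, so it is contained in R; z and the point
        -- of Q on the other side serve as the side points.
        rcases hzst with h | h
        · exact ih Q z b z.1 p.1 v₁ v₂ hv hQ hz hzQ hb hbQ le_rfl (by linarith) hv1 hv2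
            (fun w _ h1 h2 => ⟨⟨by linarith, by linarith⟩, by linarith, by linarith⟩)
            p hpP z hz ⟨by linarith, le_rfl⟩ hpv ⟨le_rfl, by linarith⟩ hzv
        · exact ih Q a z p.1 z.1 v₁ v₂ hv hQ ha haQ hz hzQ (by linarith) le_rfl hv1 hv2
            (fun w _ h1 h2 => ⟨⟨by linarith, by linarith⟩, by linarith, by linarith⟩)
            p hpP z hz ⟨le_rfl, by linarith⟩ hpv ⟨by linarith, le_rfl⟩ hzv
      have habs : ∀ z ∈ P, z ∈ Q.region → z ∈ R.region → ¬ (z.1 < s.1 ∨ t.1 < z.1) :=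
        fun z hz hzQ hzR hzst => hnC (htrans _ _ _ (step s (Or.inl rfl) z hz hzQ hzR hzst)
          (hsymm _ _ (step t (Or.inr rfl) z hz hzQ hzR hzst)))
      have hQR : R.ylo < Q.ylo ∧ Q.yhi < R.yhi := by
        rcases hQy with h | h <;> constructor <;> linarith
      -- If Q failed to reach past a vertical side of R, then a or b would be a side point in R.
      refine hnp R hR Q hQ (Rect.pierces_of_horizontal hQR.1 hQR.2 ?_ ?_)
      · by_contra! h
        exact habs a ha haQ ⟨⟨by linarith, by linarith⟩, by linarith, by linarith⟩ (Or.inl has)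
      · by_contra! h
        exact habs b hb hbQ ⟨⟨by linarith, by linarith⟩, by linarith, by linarith⟩ (Or.inr htb)
  · have hf' := isSweepEdge_of_mem hgp hf
    have hne : s.2 ≠ t.2 := fun h => hst.ne (by rw [hgp.points_y s hs t ht h])
    rw [LEdge.crosses_iff (e := ⟨s, t⟩) hst hf'.lt hne hf'.snd_ne] at hcr
    dsimp only at hcr
    rcases hcr with ⟨⟨h1, -⟩, h2⟩ | ⟨⟨-, h1⟩, -⟩
    swap
    · exact lt_asymm h1 hft
    -- Otherwise s would lie in the open box of f, or be its left end-point, which the strict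
    -- crossing excludes.
    have hleft : s.1 < f.left.1 := by
      by_contra! h
      rcases h.lt_or_eq with h | h
      · exact hf'.delaunay s hs ((LEdge.mem_interior_box hf'.lt).2 ⟨⟨h, h1⟩, h2⟩)
      · rw [hgp.points_x _ hf'.left_mem s hs h] at h2
        rcases h2 with h2 | h2
        · exact lt_irrefl _ h2.1
        · exact lt_irrefl _ h2.2
    have m1 := hmin _ hf'.left_mem ⟨hleft, hf'.lt.trans hft⟩
    have m2 := hmin _ hf'.right_mem ⟨h1, hft⟩
    -- The ends of f lie in the slab, hence outside the strip, and the crossing height is inside it;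
    -- so one end is above, the other below.
    exact hf'.not_pierces O hO (LEdge.discretelyPierces_of_vertical hl hlO hr hrO (by linarith)
      (by linarith) (by grind))

lemma isSupport_sweepGraph (hgp : GeneralPosition P 𝓡) (hnp : NonPiercing 𝓡) :
    IsSupport (sweepGraph P 𝓡) (rectHyperedges P 𝓡) := by
  rintro _ ⟨R, hR, rfl⟩
  -- Bundling the membership proofs makes reachability a relation on the whole plane.
  let C : Pt → Pt → Prop := fun p q => ∃ (hp : p ∈ P) (hq : q ∈ P) (hpR : p ∈ R.region)
    (hqR : q ∈ R.region), ((sweepGraph P 𝓡).induce {p : P | p.1 ∈ R.region}).Reachable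
      ⟨⟨p, hp⟩, hpR⟩ ⟨⟨q, hq⟩, hqR⟩
  have main : ∀ p ∈ P, ∀ q ∈ P, p ∈ R.region → q ∈ R.region → p.1 ≤ q.1 → C p q := by
    intro p hp q hq hpR hqR hpq
    -- Initially R is its own spanned rectangle O, and p and q are the side points.
    refine related_of_mem_window (C := C) hgp hnp hR ?_ ?_ ?_ ?_ _ R p q p.1 q.1 R.ylo R.yhi
      (Nat.lt_succ_self _) hR hp hpR hq hqR le_rfl le_rfl le_rfl le_rfl ?_ p hp q hq
      ⟨le_rfl, hpq⟩ hpR.2 ⟨hpq, le_rfl⟩ hqR.2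
    · exact fun a ha haR => ⟨ha, ha, haR, haR, SimpleGraph.Reachable.refl _⟩
    · exact fun a b ⟨ha, hb, haR, hbR, h⟩ => ⟨hb, ha, hbR, haR, h.symm⟩
    · exact fun a b c ⟨ha, hb, haR, hbR, h⟩ ⟨_, hc, _, hcR, h'⟩ => ⟨ha, hc, haR, hcR, h.trans h'⟩
    · intro e he hl hr
      have he' := isSweepEdge_of_mem hgp he
      refine ⟨he'.left_mem, he'.right_mem, hl, hr, SimpleGraph.Adj.reachable ?_⟩
      rw [SimpleGraph.induce_adj]
      refine (SimpleGraph.fromRel_adj _ _ _).2 ⟨?_, Or.inl he⟩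
      exact fun h => he'.lt.ne (congrArg (fun z : P => z.1.1) h)
    · exact fun z _ hz1 hz2 => ⟨⟨hpR.1.1.trans hz1.1, hz1.2.trans hqR.1.2⟩, hz2⟩
  rintro ⟨⟨p, hp⟩, hpR⟩ ⟨⟨q, hq⟩, hqR⟩
  rcases le_total p.1 q.1 with h | h
  · obtain ⟨_, _, _, _, h'⟩ := main p hp q hq hpR hqR h
    exact h'
  · obtain ⟨_, _, _, _, h'⟩ := main q hq p hp hqR hpR h
    exact h'.symm

end Support

theorem theorem1 (P : Finset Pt) (𝓡 : Finset Rect)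
    (hgp : GeneralPosition P 𝓡) (hnp : NonPiercing 𝓡) :
    IsSupport (sweepGraph P 𝓡) (rectHyperedges P 𝓡) ∧
    IsPlaneStraightLineEmbedding (sweepGraph P 𝓡) (fun p : P => (p : Pt)) ∧
    (∀ e ∈ sweepOutput P 𝓡, e.IsDelaunay P ∧ e.IsValid P 𝓡 (sweepOutput P 𝓡)) := by
  refine ⟨isSupport_sweepGraph hgp hnp, isPlaneStraightLineEmbedding_sweepGraph hgp,
    fun e he => ?_⟩
  have he' := isSweepEdge_of_mem hgp he
  exact ⟨he'.delaunay, he'.not_pierces, fun f hf => not_crosses_of_mem_sweepOutput hgp he hf⟩
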